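/- Let $T>0$, $\gamma\in\mathbb Z$, $K,p\in\mathbb N$, and $\Omega=[0,2\pi/T)$. For $x\in L_2(\mathbb R)$ write $X(\omega)=\int x(t)e^{-j\omega t}\,dt$ for its Fourier transform, and for $a\in\ell_2(\mathbb Z)$ write $A(e^{j\omega T})=\sum_{n}a[n]e^{-j\omega nT}$ (series in $L_2(\Omega)$) for its discrete-time Fourier transform (DTFT). Let $g\in L_2(\mathbb R)$, let $\tau=(t_1,\dots,t_K)$ be distinct delays in $[0,T)$, let $a_1,\dots,a_K\in\ell_2(\mathbb Z)$, and let $$x(t)=\sum_{k=1}^K\sum_{n\in\mathbb Z}a_k[n]\,g(t-t_k-nT)\in L_2(\mathbb R),$$ the series being the limit in $L_2(\mathbb R)$ of its symmetric partial sums ($|n|\le N$, $N\to\infty$). Let $s_1,\dots,s_p\in L_2(\mathbb R)$ have Fourier transforms $S_\ell$ that vanish a.e. outside $\mathcal F=[\frac{2\pi}{T}\gamma,\frac{2\pi}{T}(p+\gamma)]$, and let $c_\ell[n]=\int x(t)\,s_\ell^*(t-nT)\,dt$. For $1\le \ell,m\le p$ and $1\le k\le K$ put $$\mathbf S_{\ell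 m}(e^{j\omega T})=\tfrac1T S_\ell^*\bigl(\omega+\tfrac{2\pi}{T}(m-1+\gamma)\bigr),\qquad \mathbf W_{\ell m}(e^{j\omega T})=\mathbf S_{\ell m}(e^{j\omega T})\,G\bigl(\omega+\tfrac{2\pi}{T}(m-1+\gamma)\bigr),$$ $$\mathbf N_{mk}(\tau)=e^{-j\frac{2\pi}{T}(m-1+\gamma)t_k},\qquad \mathbf D(e^{j\omega T},\tau)=\mathrm{diag}\bigl(e^{-j\omega t_1},\dots,e^{-j\omega t_K}\bigr).$$ Call a matrix function on $\Omega$ stably invertible if its singular values lie between two positive constants for a.e. $\omega\in\Omega$. Assume that $0<\alpha\le|G(\omega)|\le\beta<\infty$ for some constants $\alpha,\beta$ and a.e. $\omega\in\mathcal F$, and that $\mathbf S$ is stably invertible. Then: 1. every $c_\ell$ is in $\ell_2(\mathbb Z)$, and $\mathbf W$ is stably invertible; 2. with $\mathbf c(e^{j\omega T})$ and $\mathbf a(e^{j\omega T})$ the vectors of the DTFTs of the $c_\ell$ and of the $a_k$, $\mathbf d=\mathbf W^{-1}\mathbf c$ and $\mathbf b=\mathbf D\mathbf a$, one has $\mathbf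 d(e^{j\omega T})=\mathbf N(\tau)\,\mathbf b(e^{j\omega T})$ for a.e. $\omega\in\Omega$; 3. if $p\ge 2K$ and no $a_k$ is the zero sequence, then these equations determine $\tau$ and $\mathbf b$ up to the numbering of the paths: if $\tau'$ consists of $K$ distinct delays in $[0,T)$ and $\mathbf d=\mathbf N(\tau')\mathbf b'$ a.e. on $\Omega$ for a function $\mathbf b':\Omega\to\mathbb C^K$, then there is a permutation $\sigma$ of $\{1,\dots,K\}$ with $t'_k=t_{\sigma(k)}$ for all $k$ and $\mathbf b'_k=\mathbf b_{\sigma(k)}$ a.e. for all $k$; 4. if $p\ge K$, then $\mathbf a(e^{j\omega T})=\mathbf D^{-1}(e^{j\omega T},\tau)\,\mathbf N^\dagger(\tau)\,\mathbf d(e^{j\omega T})$ for a.e. $\omega\in\Omega$, where $\mathbf N^\dagger$ is the Moore–Penrose pseudo-inverse. -/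

import Mathlib

open MeasureTheory Filter Topology
open scoped Matrix FourierTransform ComplexConjugate

namespace TimeDelay

noncomputable section

/-- Complex-valued finite-energy signals on the real line. -/
abbrev Signal : Type := Lp ℂ 2 (volume : Measure ℝ)

/-- The delayed signal `t ↦ g (t - s)`. -/
def delay (s : ℝ) (g : Signal) : Signal :=
  Lp.compMeasurePreserving (fun t : ℝ => t - s) (measurePreserving_sub_right volume s) g

/-- The Fourier transform in angular frequency, `X(ω) = ∫ x(t) e^{-jωt} dt`, of a finite-energy
signal (defined up to null sets). Mathlib's transform uses the kernel `e^{-2πjξt}`. -/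
def ft (x : Signal) (ω : ℝ) : ℂ :=
  (𝓕 x : Signal) (ω / (2 * Real.pi))

/-- One period `Ω = [0, 2π/T)` of the discrete-time Fourier transform. -/
def period (T : ℝ) : Set ℝ := Set.Ico 0 (2 * Real.pi / T)

/-- The working band `𝓕 = [2πγ/T, 2π(p+γ)/T]`. -/
def band (T : ℝ) (γ : ℤ) (p : ℕ) : Set ℝ :=
  Set.Icc (2 * Real.pi / T * γ) (2 * Real.pi / T * (p + γ))

/-- The term `a[n] e^{-jωnT}` of the discrete-time Fourier transform. -/
def dtftTerm (T : ℝ) (a : ℤ → ℂ) (n : ℤ) (ω : ℝ) : ℂ :=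
  a n * Complex.exp (-(Complex.I * ω * n * T))

theorem memLp_dtftTerm (T : ℝ) (a : ℤ → ℂ) (n : ℤ) :
    MemLp (dtftTerm T a n) 2 (volume.restrict (period T)) := by
  have : IsFiniteMeasure (volume.restrict (period T)) :=
    ⟨by simp [period]⟩
  refine MemLp.of_bound (C := ‖a n‖) ?_ ?_
  · exact Continuous.aestronglyMeasurable (by unfold dtftTerm; fun_prop)
  · refine Filter.Eventually.of_forall fun ω => ?_
    have h : -(Complex.I * ω * n * T) = ((-(ω * n * T) : ℝ) : ℂ) * Complex.I := by
      push_cast; ring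
    rw [dtftTerm, norm_mul, h, Complex.norm_exp_ofReal_mul_I, mul_one]

/-- The discrete-time Fourier transform `∑ₙ a[n] e^{-jωnT}` of a square-summable sequence, as the
sum of this series in `L²(Ω)`. -/
def dtft (T : ℝ) (a : ℤ → ℂ) : Lp ℂ 2 (volume.restrict (period T)) :=
  ∑' n : ℤ, (memLp_dtftTerm T a n).toLp (dtftTerm T a n)

/-- `x(t) = ∑ₖ ∑ₙ aₖ[n] g(t - tₖ - nT)`, where the series is the limit in `L²(ℝ)` of its symmetric
partial sums. -/
def IsMultipathSignal {K : ℕ} (T : ℝ) (g : Signal) (t : Fin K → ℝ) (a : Fin K → ℤ → ℂ)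
    (x : Signal) : Prop :=
  Tendsto (fun N : ℕ => ∑ k, ∑ n ∈ Finset.Icc (-(N : ℤ)) N, a k n • delay (t k + n * T) g)
    atTop (𝓝 x)

/-- The sample `c[n] = ⟨x(t), s(t - nT)⟩ = ∫ x(t) s*(t - nT) dt`. -/
def sample (T : ℝ) (x s : Signal) (n : ℤ) : ℂ :=
  ∫ t : ℝ, x t * conj (s (t - n * T))

/-- The vector of the discrete-time Fourier transforms of finitely many sequences. -/
def dtftVec {q : ℕ} (T : ℝ) (a : Fin q → ℤ → ℂ) (ω : ℝ) : Fin q → ℂ :=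
  fun k => dtft T (a k) ω

/-- The matrix `𝐒` with entries `(1/T) S_ℓ*(ω + (2π/T)(m + γ))`, `m = 0, …, p - 1`. -/
def matS {p : ℕ} (T : ℝ) (γ : ℤ) (s : Fin p → Signal) (ω : ℝ) : Matrix (Fin p) (Fin p) ℂ :=
  Matrix.of fun l m => 1 / (T : ℂ) * conj (ft (s l) (ω + 2 * Real.pi / T * ((m : ℕ) + γ)))

/-- The matrix `𝐖` with entries `(1/T) S_ℓ*(ω + (2π/T)(m + γ)) G(ω + (2π/T)(m + γ))`,
`m = 0, …, p - 1`. -/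
def matW {p : ℕ} (T : ℝ) (γ : ℤ) (s : Fin p → Signal) (g : Signal) (ω : ℝ) :
    Matrix (Fin p) (Fin p) ℂ :=
  Matrix.of fun l m =>
    1 / (T : ℂ) * conj (ft (s l) (ω + 2 * Real.pi / T * ((m : ℕ) + γ))) *
      ft g (ω + 2 * Real.pi / T * ((m : ℕ) + γ))

/-- The Vandermonde matrix `𝐍(τ)` with entries `e^{-j(2π/T)(m + γ)tₖ}`, `m = 0, …, p - 1`. -/
def matN {K : ℕ} (p : ℕ) (T : ℝ) (γ : ℤ) (t : Fin K → ℝ) : Matrix (Fin p) (Fin K) ℂ :=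
  Matrix.of fun m k =>
    Complex.exp (-(Complex.I * (2 * Real.pi / T) * ((m : ℕ) + γ) * t k))

/-- The diagonal matrix `𝐃` with diagonal entries `e^{-jωtₖ}`. -/
def matD {K : ℕ} (t : Fin K → ℝ) (ω : ℝ) : Matrix (Fin K) (Fin K) ℂ :=
  Matrix.diagonal fun k => Complex.exp (-(Complex.I * ω * t k))

/-- A matrix function on `Ω` is stably invertible a.e.: its singular values lie between two positive
constants for almost every `ω ∈ Ω`. -/
def StablyInvertible {p : ℕ} (T : ℝ) (M : ℝ → Matrix (Fin p) (Fin p) ℂ) : Prop :=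
  ∃ α β : ℝ, 0 < α ∧ ∀ᵐ ω ∂volume.restrict (period T), ∀ v : EuclideanSpace ℂ (Fin p),
    α * ‖v‖ ≤ ‖Matrix.toEuclideanLin (M ω) v‖ ∧ ‖Matrix.toEuclideanLin (M ω) v‖ ≤ β * ‖v‖

/-- The vector `𝐛 = 𝐃 𝐚`. -/
def vecB {K : ℕ} (T : ℝ) (t : Fin K → ℝ) (a : Fin K → ℤ → ℂ) (ω : ℝ) : Fin K → ℂ :=
  matD t ω *ᵥ dtftVec T a ω

/-- The modified measurement vector `𝐝 = 𝐖⁻¹ 𝐜`. -/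
def vecD {p : ℕ} (T : ℝ) (γ : ℤ) (s : Fin p → Signal) (g x : Signal) (ω : ℝ) : Fin p → ℂ :=
  (matW T γ s g ω)⁻¹ *ᵥ dtftVec T (fun l => sample T x (s l)) ω

/-- The four Penrose equations. -/
structure IsMoorePenrose {m n : ℕ} (A : Matrix (Fin m) (Fin n) ℂ)
    (P : Matrix (Fin n) (Fin m) ℂ) : Prop where
  mul_mul_self : A * P * A = A
  self_mul_mul : P * A * P = P
  left_herm : (A * P)ᴴ = A * P
  right_herm : (P * A)ᴴ = P * A

theorem IsMoorePenrose.unique {m n : ℕ} {A : Matrix (Fin m) (Fin n) ℂ}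
    {P Q : Matrix (Fin n) (Fin m) ℂ} (hP : IsMoorePenrose A P) (hQ : IsMoorePenrose A Q) :
    P = Q := by
  have h1 : A * P = A * Q := by
    calc A * P = (A * P)ᴴ := hP.left_herm.symm
      _ = (A * Q * (A * P))ᴴ := by rw [← Matrix.mul_assoc, hQ.mul_mul_self]
      _ = A * P * (A * Q) := by rw [Matrix.conjTranspose_mul, hP.left_herm, hQ.left_herm]
      _ = A * Q := by rw [← Matrix.mul_assoc, hP.mul_mul_self]
  have h2 : P * A = Q * A := by
    calc P * A = (P * A)ᴴ := hP.right_herm.symm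
      _ = (P * A * (Q * A))ᴴ := by
        rw [Matrix.mul_assoc, ← Matrix.mul_assoc A, hQ.mul_mul_self]
      _ = Q * A * (P * A) := by rw [Matrix.conjTranspose_mul, hP.right_herm, hQ.right_herm]
      _ = Q * A := by rw [Matrix.mul_assoc, ← Matrix.mul_assoc A, hP.mul_mul_self]
  calc P = P * A * P := hP.self_mul_mul.symm
    _ = Q * A * Q := by rw [h2, Matrix.mul_assoc, h1, Matrix.mul_assoc]
    _ = Q := hQ.self_mul_mul

theorem IsMoorePenrose.exists {m n : ℕ} (A : Matrix (Fin m) (Fin n) ℂ) :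
    ∃ P, IsMoorePenrose A P := by
  have hH : (Aᴴ * A).IsHermitian := Matrix.isHermitian_conjTranspose_mul_self A
  have key : ∀ H : Matrix (Fin n) (Fin n) ℂ, H.IsHermitian → ∃ B : Matrix (Fin n) (Fin n) ℂ,
      Bᴴ = B ∧ B * H * B = B ∧ H * B * H = H ∧ B * H = H * B := by
    intro H hH
    obtain ⟨e, d, hs⟩ : ∃ (e : Matrix (Fin n) (Fin n) ℂ ≃⋆ₐ[ℂ] Matrix (Fin n) (Fin n) ℂ)
        (d : Fin n → ℝ), H = e (Matrix.diagonal fun i => (d i : ℂ)) :=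
      ⟨_, _, hH.spectral_theorem⟩
    refine ⟨e (Matrix.diagonal fun i => (d i : ℂ)⁻¹), ?_, ?_, ?_, ?_⟩
    · rw [← Matrix.star_eq_conjTranspose, ← map_star, Matrix.star_eq_conjTranspose,
        Matrix.diagonal_conjTranspose]
      congr 2
      ext i
      simp
    all_goals
      simp only [hs, ← map_mul, Matrix.diagonal_mul_diagonal]
      congr 2
      ext i
      by_cases h : d i = 0 <;> simp [h]
  obtain ⟨B, hB, hBHB, hHBH, hc⟩ := key _ hH
  refine ⟨B * Aᴴ, ?_, ?_, ?_, ?_⟩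
  · have h0 : (A * B * (Aᴴ * A) - A)ᴴ * (A * B * (Aᴴ * A) - A) = 0 := by
      have h1 : Aᴴ * (A * B * (Aᴴ * A) - A) = 0 := by
        rw [Matrix.mul_sub, sub_eq_zero]
        simpa only [Matrix.mul_assoc] using hHBH
      have h2 : A * B * (Aᴴ * A) - A = A * (B * (Aᴴ * A) - 1) := by
        rw [Matrix.mul_sub, Matrix.mul_one, Matrix.mul_assoc]
      conv_lhs => rw [h2, Matrix.conjTranspose_mul, Matrix.mul_assoc, ← h2, h1, Matrix.mul_zero]
    open scoped ComplexOrder in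
    have := sub_eq_zero.mp (Matrix.conjTranspose_mul_self_eq_zero.mp h0)
    simpa only [Matrix.mul_assoc] using this
  · calc B * Aᴴ * A * (B * Aᴴ) = B * (Aᴴ * A) * B * Aᴴ := by simp only [Matrix.mul_assoc]
      _ = B * Aᴴ := by rw [hBHB]
  · simp only [Matrix.conjTranspose_mul, Matrix.conjTranspose_conjTranspose, hB, Matrix.mul_assoc]
  · rw [Matrix.mul_assoc, Matrix.conjTranspose_mul, hH.eq, hB, hc]

/-- The Moore–Penrose pseudo-inverse `A†`. -/
def pinv {m n : ℕ} (A : Matrix (Fin m) (Fin n) ℂ) : Matrix (Fin n) (Fin m) ℂ :=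
  Classical.choose (IsMoorePenrose.exists A)

theorem isMoorePenrose_pinv {m n : ℕ} (A : Matrix (Fin m) (Fin n) ℂ) :
    IsMoorePenrose A (pinv A) :=
  Classical.choose_spec (IsMoorePenrose.exists A)

end

end TimeDelay

open TimeDelay

/-! Folding the frequency axis onto the period `Ω`, the samples `c_ℓ[n]` are Fourier coefficients of
the `ℓ`-th entry of `𝐒` times the vector of the `p` bands of `X`. As `X` is `G` times
`∑ₖ e^{-jωtₖ} Aₖ` and every `Aₖ` is `2π/T`-periodic, this vector of bands is `diag(G) 𝐍 𝐛`, so that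
`𝐜 = 𝐖 𝐍 𝐛`. The columns of `𝐍` at distinct delays in `[0, T)` form a Vandermonde matrix up to
nonzero factors. Two configurations of `K` paths involve at most `2K ≤ p` delays, so `𝐍 𝐛`
determines the spike train `∑ₖ bₖ δ_{tₖ}`, hence the delays whose amplitudes do not vanish a.e. -/

namespace TimeDelay

section ConvergenceInMeasure

variable {α ι κ : Type*} [MeasurableSpace α] {μ : Measure α} [Fintype ι]
  {E : ι → Type*} [∀ i, PseudoEMetricSpace (E i)]

theorem tendstoInMeasure_pi {l : Filter κ} {f : κ → α → ∀ i, E i} {g : α → ∀ i, E i}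
    (h : ∀ i, TendstoInMeasure μ (fun n x => f n x i) l fun x => g x i) :
    TendstoInMeasure μ f l g := by
  intro ε hε
  refine tendsto_of_tendsto_of_tendsto_of_le_of_le tendsto_const_nhds
    (by simpa using tendsto_finsetSum Finset.univ fun i _ => h i ε hε)
    (fun _ => zero_le) fun n => ?_
  calc μ {x | ε ≤ edist (f n x) (g x)}
      ≤ μ (⋃ i, {x | ε ≤ edist (f n x i) (g x i)}) := by
        refine measure_mono fun x hx => ?_
        simpa [edist_pi_def, Finset.le_sup_iff hε] using hx
    _ ≤ ∑ i, μ {x | ε ≤ edist (f n x i) (g x i)} := measure_iUnion_fintype_le _ _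

end ConvergenceInMeasure

section AngularFourierTransform

theorem quasiMeasurePreserving_div_two_pi :
    Measure.QuasiMeasurePreserving (fun ω : ℝ => ω / (2 * Real.pi)) volume volume := by
  simpa only [smul_eq_mul, div_eq_inv_mul] using
    Measure.quasiMeasurePreserving_smul (volume : Measure ℝ) (inv_ne_zero Real.two_pi_pos.ne')

theorem memLp_ft (x : Signal) : MemLp (ft x) 2 volume := by
  have hmeas : AEStronglyMeasurable (ft x) volume :=
    (Lp.aestronglyMeasurable (𝓕 x : Signal)).comp_quasiMeasurePreserving
      quasiMeasurePreserving_div_two_pi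
  have hsq : Integrable (fun ξ => ‖(𝓕 x : Signal) ξ‖ ^ 2) volume :=
    (memLp_two_iff_integrable_sq_norm (Lp.aestronglyMeasurable _)).1 (Lp.memLp _)
  exact (memLp_two_iff_integrable_sq_norm hmeas).2 (hsq.comp_div Real.two_pi_pos.ne')

theorem ft_finsetSum_smul_ae_eq {ι : Type*} (S : Finset ι) (c : ι → ℂ) (f : ι → Signal) :
    ft (∑ i ∈ S, c i • f i) =ᵐ[volume] fun ω => ∑ i ∈ S, c i * ft (f i) ω := by
  have hlin : (𝓕 (∑ i ∈ S, c i • f i) : Signal) = ∑ i ∈ S, c i • (𝓕 (f i) : Signal) := by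
    change Lp.fourierTransformₗᵢ ℝ ℂ _ = ∑ i ∈ S, c i • Lp.fourierTransformₗᵢ ℝ ℂ (f i)
    simp only [map_sum, map_smul]
  have hfreq : (𝓕 (∑ i ∈ S, c i • f i) : Signal) =ᵐ[volume]
      fun ξ => ∑ i ∈ S, c i * (𝓕 (f i) : Signal) ξ := by
    rw [hlin]
    have hsmul : ∀ᵐ ξ : ℝ, ∀ i ∈ S, (c i • (𝓕 (f i) : Signal) : Signal) ξ =
        c i * (𝓕 (f i) : Signal) ξ :=
      (Finset.eventually_all S).2 fun i _ => Lp.coeFn_smul (c i) (𝓕 (f i) : Signal)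
    filter_upwards [Lp.coeFn_finsetSum S fun i => c i • (𝓕 (f i) : Signal), hsmul]
      with ξ hsum hsmul
    rw [hsum, Finset.sum_apply]
    exact Finset.sum_congr rfl hsmul
  exact quasiMeasurePreserving_div_two_pi.ae hfreq

theorem exists_seq_tendsto_ae_ft {f : ℕ → Signal} {x : Signal} (h : Tendsto f atTop (𝓝 x)) :
    ∃ ns : ℕ → ℕ, StrictMono ns ∧
      ∀ᵐ ω : ℝ, Tendsto (fun n => ft (f (ns n)) ω) atTop (𝓝 (ft x ω)) := by
  have hF : Tendsto (fun n => (𝓕 (f n) : Signal)) atTop (𝓝 (𝓕 x)) :=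
    ((Lp.fourierTransformₗᵢ ℝ ℂ).continuous.tendsto x).comp h
  obtain ⟨ns, hns, hae⟩ := (tendstoInMeasure_of_tendsto_Lp hF).exists_seq_tendsto_ae
  exact ⟨ns, hns, quasiMeasurePreserving_div_two_pi.ae hae⟩

theorem ft_toLp_ae_eq (f : SchwartzMap ℝ ℂ) :
    ft (f.toLp 2) =ᵐ[volume] fun ω => 𝓕 (f : ℝ → ℂ) (ω / (2 * Real.pi)) := by
  have h : (𝓕 (f.toLp 2) : Signal) =ᵐ[volume] 𝓕 (f : ℝ → ℂ) := by
    rw [SchwartzMap.toLp_fourier_eq, ← SchwartzMap.fourier_coe]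
    exact (𝓕 f).coeFn_toLp 2 volume
  exact quasiMeasurePreserving_div_two_pi.ae h

theorem fourier_comp_sub_right (f : ℝ → ℂ) (s ω : ℝ) :
    𝓕 (fun t => f (t - s)) (ω / (2 * Real.pi)) =
      Complex.exp (-(Complex.I * ω * s)) * 𝓕 f (ω / (2 * Real.pi)) := by
  have hshift := congrFun (VectorFourier.fourierIntegral_comp_add_right Real.fourierChar volume
    (innerₗ ℝ) f (-s)) (ω / (2 * Real.pi))
  have hphase : (Real.fourierChar (innerₗ ℝ (-s) (ω / (2 * Real.pi))) : ℂ) =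
      Complex.exp (-(Complex.I * ω * s)) := by
    rw [Real.fourierChar_apply]
    congr 1
    simp only [map_neg, LinearMap.neg_apply, innerₗ_apply_apply, RCLike.inner_apply,
      Real.ringHom_apply, mul_neg, Complex.ofReal_neg, Complex.ofReal_mul, Complex.ofReal_ofNat,
      Complex.ofReal_div, neg_mul, neg_inj]
    field_simp
  rw [← hphase]
  exact hshift

theorem ft_delay_ae_eq (s : ℝ) (g : Signal) :
    ft (delay s g) =ᵐ[volume] fun ω => Complex.exp (-(Complex.I * ω * s)) * ft g ω := by
  obtain ⟨f, hf⟩ : ∃ f : ℕ → SchwartzMap ℝ ℂ, Tendsto (fun n => (f n).toLp 2) atTop (𝓝 g) := by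
    obtain ⟨h, hmem, hlim⟩ := mem_closure_iff_seq_limit.1
      (SchwartzMap.denseRange_toLpCLM (E := ℝ) (F := ℂ) (μ := volume) (p := 2)
        ENNReal.ofNat_ne_top g)
    choose f hf using hmem
    exact ⟨f, hlim.congr fun n => (hf n).symm⟩
  have hfs : Tendsto (fun n => delay s ((f n).toLp 2)) atTop (𝓝 (delay s g)) :=
    ((Lp.isometry_compMeasurePreserving
      (measurePreserving_sub_right volume s)).continuous.tendsto g).comp hf
  have hschwartz : ∀ᵐ ω : ℝ, ∀ n, ft (delay s ((f n).toLp 2)) ω =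
      Complex.exp (-(Complex.I * ω * s)) * ft ((f n).toLp 2) ω := by
    refine ae_all_iff.2 fun n => ?_
    filter_upwards [ft_toLp_ae_eq (f n), ft_toLp_ae_eq ((f n).compSubConstCLM ℂ s)]
      with ω hft hfts
    rw [hft, ← fourier_comp_sub_right]
    exact hfts
  obtain ⟨ns, hns, hae⟩ := exists_seq_tendsto_ae_ft hf
  obtain ⟨ms, hms, hae_s⟩ := exists_seq_tendsto_ae_ft (hfs.comp hns.tendsto_atTop)
  filter_upwards [hae, hae_s, hschwartz] with ω hω hωs heq
  refine tendsto_nhds_unique hωs ?_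
  simp only [Function.comp_apply, heq]
  exact (hω.comp hms.tendsto_atTop).const_mul _

theorem inner_eq_integral_ft (x y : Signal) :
    inner ℂ x y = (2 * Real.pi : ℂ)⁻¹ * ∫ ω : ℝ, conj (ft x ω) * ft y ω := by
  have hscale := Measure.integral_comp_div
    (fun ξ => conj ((𝓕 x : Signal) ξ) * (𝓕 y : Signal) ξ) (2 * Real.pi)
  rw [← Lp.inner_fourier_eq, L2.inner_def]
  simp only [ft, hscale, abs_of_pos Real.two_pi_pos, Complex.real_smul, RCLike.inner_apply']
  push_cast
  rw [inv_mul_cancel_left₀ (by exact_mod_cast Real.two_pi_pos.ne')]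

theorem sample_eq_inner (T : ℝ) (x s : Signal) (n : ℤ) :
    sample T x s n = inner ℂ (delay (n * T) s) x := by
  rw [sample, L2.inner_def]
  refine integral_congr_ae ?_
  filter_upwards [Lp.coeFn_compMeasurePreserving s (measurePreserving_sub_right volume (n * T))]
    with t ht
  rw [RCLike.inner_apply, delay, ht, Function.comp_apply]

theorem sample_eq_integral_ft (T : ℝ) (x s : Signal) (n : ℤ) :
    sample T x s n = (2 * Real.pi : ℂ)⁻¹ *
      ∫ ω : ℝ, conj (ft s ω) * ft x ω * Complex.exp (Complex.I * ω * n * T) := by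
  rw [sample_eq_inner, inner_eq_integral_ft]
  congr 1
  refine integral_congr_ae ?_
  filter_upwards [ft_delay_ae_eq (n * T) s] with ω hω
  rw [hω, map_mul, ← Complex.exp_conj]
  simp only [map_neg, map_mul, Complex.conj_I, Complex.conj_ofReal, neg_mul, neg_neg]
  push_cast
  ring_nf

end AngularFourierTransform

section Band

variable {T : ℝ} {γ : ℤ} {p : ℕ}

theorem period_length_pos (hT : 0 < T) : 0 < 2 * Real.pi / T := by
  positivity

theorem add_mem_band (hT : 0 < T) {ω : ℝ} (hω : ω ∈ period T) (m : Fin p) :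
    ω + 2 * Real.pi / T * ((m : ℕ) + γ) ∈ band T γ p := by
  obtain ⟨hω_nonneg, hω_lt⟩ := hω
  have hm : ((m : ℕ) : ℝ) + 1 ≤ p := by exact_mod_cast m.2
  constructor
  · calc 2 * Real.pi / T * γ ≤ 2 * Real.pi / T * ((m : ℕ) + γ) := by gcongr; simp
      _ ≤ ω + 2 * Real.pi / T * ((m : ℕ) + γ) := le_add_of_nonneg_left hω_nonneg
  · calc ω + 2 * Real.pi / T * ((m : ℕ) + γ)
        ≤ 2 * Real.pi / T + 2 * Real.pi / T * ((m : ℕ) + γ) := by gcongr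
      _ = 2 * Real.pi / T * (((m : ℕ) + 1) + γ) := by ring
      _ ≤ 2 * Real.pi / T * (p + γ) := by gcongr

theorem ae_restrict_period_of_ae_restrict_band (hT : 0 < T) {P : ℝ → Prop}
    (h : ∀ᵐ ω ∂volume.restrict (band T γ p), P ω) :
    ∀ᵐ ω ∂volume.restrict (period T), ∀ m : Fin p, P (ω + 2 * Real.pi / T * ((m : ℕ) + γ)) := by
  refine ae_all_iff.2 fun m => ?_
  have hband := (ae_restrict_iff' measurableSet_Icc).1 h
  rw [period, ae_restrict_iff' measurableSet_Ico]
  filter_upwards [(quasiMeasurePreserving_add_right volume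
    (2 * Real.pi / T * ((m : ℕ) + γ))).ae hband] with ω hP hω
  exact hP (add_mem_band hT hω m)

theorem integral_eq_sum_integral_period {E : Type*} [NormedAddCommGroup E] [NormedSpace ℝ E]
    (hT : 0 < T) {f : ℝ → E} (hf : Integrable f volume)
    (hf_band : ∀ᵐ ω : ℝ, ω ∉ band T γ p → f ω = 0) :
    ∫ ω, f ω = ∑ m : Fin p, ∫ ω in period T, f (ω + 2 * Real.pi / T * ((m : ℕ) + γ)) := by
  have hL : 0 ≤ 2 * Real.pi / T := by positivity
  let node : ℕ → ℝ := fun m => 2 * Real.pi / T * (m + γ)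
  have hstep : ∀ m : ℕ, ∫ ω in node m..node (m + 1), f ω =
      ∫ ω in period T, f (ω + 2 * Real.pi / T * ((m : ℕ) + γ)) := fun m => by
    rw [period, integral_Ico_eq_integral_Ioc, ← intervalIntegral.integral_of_le hL,
      intervalIntegral.integral_comp_add_right]
    congr 1 <;> simp only [node] <;> push_cast <;> ring
  have hnode : node 0 ≤ node p := by
    simp only [node]
    gcongr
    exact Nat.zero_le p
  calc ∫ ω, f ω = ∫ ω in band T γ p, f ω :=
        (setIntegral_eq_integral_of_ae_compl_eq_zero hf_band).symm
    _ = ∫ ω in node 0..node p, f ω := by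
        rw [intervalIntegral.integral_of_le hnode, ← integral_Icc_eq_integral_Ioc]
        simp only [node, band, CharP.cast_eq_zero, zero_add]
    _ = ∑ m ∈ Finset.range p, ∫ ω in node m..node (m + 1), f ω :=
        (intervalIntegral.sum_integral_adjacent_intervals
          fun _ _ => hf.intervalIntegrable).symm
    _ = ∑ m : Fin p, ∫ ω in node m..node (m + 1), f ω :=
        (Fin.sum_univ_eq_sum_range (fun m => ∫ ω in node m..node (m + 1), f ω) p).symm
    _ = ∑ m : Fin p, ∫ ω in period T, f (ω + 2 * Real.pi / T * ((m : ℕ) + γ)) :=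
        Finset.sum_congr rfl fun m _ => hstep m

end Band

section FourierBasis

variable {T : ℝ}

/-- The exponential `e^{-jωnT}` as an element of `L²(Ω)`. -/
noncomputable def expLp (T : ℝ) (n : ℤ) : Lp ℂ 2 (volume.restrict (period T)) :=
  (memLp_dtftTerm T 1 n).toLp (dtftTerm T 1 n)

theorem expLp_ae_eq (T : ℝ) (n : ℤ) : expLp T n =ᵐ[volume.restrict (period T)]
    fun ω : ℝ => Complex.exp (-(Complex.I * ω * n * T)) := by
  filter_upwards [(memLp_dtftTerm T 1 n).coeFn_toLp] with ω hω
  rw [expLp, hω, dtftTerm, Pi.one_apply, one_mul]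

theorem toLp_dtftTerm (T : ℝ) (a : ℤ → ℂ) (n : ℤ) :
    (memLp_dtftTerm T a n).toLp (dtftTerm T a n) = a n • expLp T n := by
  rw [expLp, ← MemLp.toLp_const_smul]
  refine MemLp.toLp_congr _ _ (Eventually.of_forall fun ω => ?_)
  simp [dtftTerm]

theorem inner_expLp (T : ℝ) (n : ℤ) (f : Lp ℂ 2 (volume.restrict (period T))) :
    inner ℂ (expLp T n) f =
      ∫ ω in period T, f ω * Complex.exp (Complex.I * ω * n * T) := by
  rw [L2.inner_def]
  refine integral_congr_ae ?_
  filter_upwards [expLp_ae_eq T n] with ω hω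
  rw [hω, RCLike.inner_apply, ← Complex.exp_conj]
  simp

theorem inner_expLp_eq_fourierCoeffOn (hT : 0 < T) (n : ℤ)
    (f : Lp ℂ 2 (volume.restrict (period T))) :
    inner ℂ (expLp T n) f =
      (2 * Real.pi / T : ℝ) * fourierCoeffOn (period_length_pos hT) f (-n) := by
  have hL := period_length_pos hT
  rw [inner_expLp, fourierCoeffOn_eq_integral, intervalIntegral.integral_of_le hL.le,
    ← integral_Ico_eq_integral_Ioc, Complex.real_smul, sub_zero, ← mul_assoc,
    ← Complex.ofReal_mul, mul_one_div_cancel hL.ne', Complex.ofReal_one, one_mul]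
  congr 1 with ω
  rw [neg_neg, fourier_coe_apply, smul_eq_mul, mul_comm]
  congr 2
  push_cast
  have hT' : (T : ℂ) ≠ 0 := by exact_mod_cast hT.ne'
  have hpi : (Real.pi : ℂ) ≠ 0 := by exact_mod_cast Real.pi_ne_zero
  field_simp

theorem eq_zero_of_inner_expLp_eq_zero (hT : 0 < T)
    {f : Lp ℂ 2 (volume.restrict (period T))} (h : ∀ n, inner ℂ (expLp T n) f = 0) : f = 0 := by
  have hL := period_length_pos hT
  have hres : volume.restrict (Set.Ioc 0 (2 * Real.pi / T)) = volume.restrict (period T) :=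
    (Measure.restrict_congr_set Ico_ae_eq_Ioc).symm
  have hcoeff : ∀ n, fourierCoeffOn hL f n = 0 := fun n => by
    have hn := h (-n)
    rw [inner_expLp_eq_fourierCoeffOn hT, neg_neg] at hn
    exact (mul_eq_zero.1 hn).resolve_left (Complex.ofReal_ne_zero.2 hL.ne')
  have hparseval := tsum_sq_fourierCoeffOn (f := f) hL (by rw [hres]; exact Lp.memLp f)
  simp only [hcoeff, norm_zero, ne_eq, OfNat.ofNat_ne_zero, not_false_eq_true, zero_pow, tsum_zero,
    intervalIntegral.integral_of_le hL.le, hres, sub_zero] at hparseval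
  have hnorm : ∫ ω in period T, ‖f ω‖ ^ 2 = 0 :=
    (smul_eq_zero.1 hparseval.symm).resolve_left (inv_ne_zero hL.ne')
  rw [integral_eq_zero_iff_of_nonneg (fun _ => by positivity)
    ((memLp_two_iff_integrable_sq_norm (Lp.aestronglyMeasurable f)).1 (Lp.memLp f))] at hnorm
  refine (Lp.eq_zero_iff_ae_eq_zero).2 ?_
  filter_upwards [hnorm] with ω hω
  simpa using hω

theorem inner_expLp_expLp (hT : 0 < T) (m n : ℤ) :
    inner ℂ (expLp T m) (expLp T n) = if m = n then ((2 * Real.pi / T : ℝ) : ℂ) else 0 := by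
  have hL := period_length_pos hT
  have hT' : (T : ℂ) ≠ 0 := by exact_mod_cast hT.ne'
  have hint : inner ℂ (expLp T m) (expLp T n) =
      ∫ ω : ℝ in 0..(2 * Real.pi / T), Complex.exp (Complex.I * (m - n : ℤ) * T * ω) := by
    rw [inner_expLp, intervalIntegral.integral_of_le hL.le, ← integral_Ico_eq_integral_Ioc]
    refine integral_congr_ae ?_
    filter_upwards [expLp_ae_eq T n] with ω hω
    rw [hω, ← Complex.exp_add]
    congr 1
    push_cast
    ring
  rw [hint]
  split_ifs with hmn
  · simp [hmn]
  · have hrate : Complex.I * ((m - n : ℤ) : ℂ) * T ≠ 0 :=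
      mul_ne_zero (mul_ne_zero Complex.I_ne_zero (by exact_mod_cast sub_ne_zero.2 hmn)) hT'
    have hwind : Complex.I * ((m - n : ℤ) : ℂ) * T * ((2 * Real.pi / T : ℝ) : ℂ) =
        ((m - n : ℤ) : ℂ) * (2 * Real.pi * Complex.I) := by
      push_cast
      field_simp
    rw [integral_exp_mul_complex hrate, hwind, Complex.exp_int_mul_two_pi_mul_I]
    simp

/-- The common `L²(Ω)`-norm `√(2π/T)` of the exponentials `e^{-jωnT}`, as a complex number. -/
noncomputable def expNorm (T : ℝ) : ℂ := (√(2 * Real.pi / T) : ℝ)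

theorem expNorm_ne_zero (hT : 0 < T) : expNorm T ≠ 0 :=
  Complex.ofReal_ne_zero.2 (Real.sqrt_pos.2 (period_length_pos hT)).ne'

theorem expNorm_mul_self (hT : 0 < T) : expNorm T * expNorm T = (2 * Real.pi / T : ℝ) := by
  rw [expNorm, ← Complex.ofReal_mul, Real.mul_self_sqrt (period_length_pos hT).le]

theorem conj_expNorm_inv (T : ℝ) : conj (expNorm T)⁻¹ = (expNorm T)⁻¹ := by
  rw [expNorm, ← Complex.ofReal_inv, Complex.conj_ofReal]

theorem orthonormal_smul_expLp (hT : 0 < T) :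
    Orthonormal ℂ fun n => (expNorm T)⁻¹ • expLp T n := by
  refine orthonormal_iff_ite.2 fun m n => ?_
  rw [inner_smul_left, inner_smul_right, inner_expLp_expLp hT, ← expNorm_mul_self hT,
    conj_expNorm_inv]
  split_ifs
  · have := expNorm_ne_zero hT
    field_simp
  · simp

/-- The Hilbert basis of `L²(Ω)` of the normalized exponentials `e^{-jωnT}`. -/
noncomputable def expBasis (hT : 0 < T) :
    HilbertBasis ℤ ℂ (Lp ℂ 2 (volume.restrict (period T))) :=
  HilbertBasis.mkOfOrthogonalEqBot (orthonormal_smul_expLp hT) <| by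
    refine (Submodule.eq_bot_iff _).2 fun f hf => eq_zero_of_inner_expLp_eq_zero hT fun n => ?_
    have hn := (Submodule.mem_orthogonal _ _).1 hf _ (Submodule.subset_span ⟨n, rfl⟩)
    rw [inner_smul_left, mul_eq_zero] at hn
    exact hn.resolve_left ((map_ne_zero _).2 (inv_ne_zero (expNorm_ne_zero hT)))

theorem expBasis_apply (hT : 0 < T) (n : ℤ) :
    expBasis hT n = (expNorm T)⁻¹ • expLp T n := by
  rw [expBasis, HilbertBasis.coe_mkOfOrthogonalEqBot]

theorem hasSum_smul_expLp (hT : 0 < T) {a : ℤ → ℂ} (ha : Memℓp a 2) :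
    HasSum (fun n => a n • expLp T n) (expNorm T • (expBasis hT).repr.symm ⟨a, ha⟩) := by
  refine (((expBasis hT).hasSum_repr_symm ⟨a, ha⟩).const_smul (expNorm T)).congr_fun fun n => ?_
  rw [expBasis_apply, smul_comm, smul_inv_smul₀ (expNorm_ne_zero hT)]

theorem dtft_eq_smul_repr_symm (hT : 0 < T) {a : ℤ → ℂ} (ha : Memℓp a 2) :
    dtft T a = expNorm T • (expBasis hT).repr.symm ⟨a, ha⟩ := by
  simp only [dtft, toLp_dtftTerm, (hasSum_smul_expLp hT ha).tsum_eq]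

theorem dtft_ne_zero (hT : 0 < T) {a : ℤ → ℂ} (ha : Memℓp a 2) (h0 : a ≠ 0) :
    dtft T a ≠ 0 := by
  rw [dtft_eq_smul_repr_symm hT ha]
  refine smul_ne_zero (expNorm_ne_zero hT) fun h => h0 ?_
  exact congrArg Subtype.val ((map_eq_zero_iff _ (expBasis hT).repr.symm.injective).1 h)

theorem tendsto_sum_Icc_smul_expLp (hT : 0 < T) {a : ℤ → ℂ} (ha : Memℓp a 2) :
    Tendsto (fun N : ℕ => ∑ n ∈ Finset.Icc (-(N : ℤ)) N, a n • expLp T n) atTop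
      (𝓝 (dtft T a)) := by
  rw [dtft_eq_smul_repr_symm hT ha]
  refine (hasSum_smul_expLp hT ha).comp (tendsto_atTop_finset_of_monotone ?_ ?_)
  · exact fun M N hMN => Finset.Icc_subset_Icc (by simpa using hMN) (by simpa using hMN)
  · exact fun n => ⟨n.natAbs, Finset.mem_Icc.2 ⟨by omega, by omega⟩⟩

theorem eq_smul_repr_of_forall_eq_inner_expLp (hT : 0 < T) {c : ℤ → ℂ}
    {f : Lp ℂ 2 (volume.restrict (period T))}
    (h : ∀ n, c n = ((T / (2 * Real.pi) : ℝ) : ℂ) * inner ℂ (expLp T n) f) :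
    c = (expNorm T)⁻¹ • ⇑((expBasis hT).repr f) := by
  funext n
  rw [h, Pi.smul_apply, HilbertBasis.repr_apply_apply, expBasis_apply, inner_smul_left,
    conj_expNorm_inv, smul_eq_mul, ← mul_assoc, ← mul_inv, expNorm_mul_self hT,
    ← Complex.ofReal_inv, inv_div]

theorem memℓp_of_forall_eq_inner_expLp (hT : 0 < T) {c : ℤ → ℂ}
    {f : Lp ℂ 2 (volume.restrict (period T))}
    (h : ∀ n, c n = ((T / (2 * Real.pi) : ℝ) : ℂ) * inner ℂ (expLp T n) f) : Memℓp c 2 := by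
  rw [eq_smul_repr_of_forall_eq_inner_expLp hT h]
  exact (lp.memℓp _).const_smul _

theorem dtft_eq_of_forall_eq_inner_expLp (hT : 0 < T) {c : ℤ → ℂ}
    {f : Lp ℂ 2 (volume.restrict (period T))}
    (h : ∀ n, c n = ((T / (2 * Real.pi) : ℝ) : ℂ) * inner ℂ (expLp T n) f) : dtft T c = f := by
  have hc : (⟨c, memℓp_of_forall_eq_inner_expLp hT h⟩ : lp (fun _ : ℤ => ℂ) 2) =
      (expNorm T)⁻¹ • (expBasis hT).repr f :=
    Subtype.ext (eq_smul_repr_of_forall_eq_inner_expLp hT h)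
  rw [dtft_eq_smul_repr_symm hT (memℓp_of_forall_eq_inner_expLp hT h), hc, map_smul,
    LinearIsometryEquiv.symm_apply_apply, smul_inv_smul₀ (expNorm_ne_zero hT)]

end FourierBasis

section StablyInvertible

variable {T : ℝ} {p : ℕ} {M N : ℝ → Matrix (Fin p) (Fin p) ℂ}

theorem StablyInvertible.ae_norm_le (hM : StablyInvertible T M) :
    ∃ C : ℝ, ∀ᵐ ω ∂volume.restrict (period T), ∀ l m, ‖M ω l m‖ ≤ C := by
  obtain ⟨α, β, -, h⟩ := hM
  refine ⟨β, ?_⟩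
  filter_upwards [h] with ω hω l m
  calc ‖M ω l m‖ = ‖Matrix.toEuclideanLin (M ω) (EuclideanSpace.single m 1) l‖ := by
        simp [Matrix.toEuclideanLin]
    _ ≤ ‖Matrix.toEuclideanLin (M ω) (EuclideanSpace.single m 1)‖ := PiLp.norm_apply_le _ l
    _ ≤ β * ‖EuclideanSpace.single m (1 : ℂ)‖ := (hω _).2
    _ = β := by rw [PiLp.norm_single, norm_one, mul_one]

theorem StablyInvertible.ae_isUnit_det (hM : StablyInvertible T M) :
    ∀ᵐ ω ∂volume.restrict (period T), IsUnit (M ω).det := by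
  obtain ⟨α, β, hα, h⟩ := hM
  filter_upwards [h] with ω hω
  rw [← Matrix.isUnit_iff_isUnit_det, ← Matrix.mulVec_injective_iff_isUnit,
    ← Matrix.coe_mulVecLin, injective_iff_map_eq_zero]
  intro v hv
  have hlower := (hω (WithLp.toLp 2 v)).1
  have hzero : Matrix.toEuclideanLin (M ω) (WithLp.toLp 2 v) = 0 :=
    congrArg (WithLp.toLp 2) hv
  rw [hzero, norm_zero] at hlower
  have hnorm : ‖WithLp.toLp 2 v‖ ≤ 0 := nonpos_of_mul_nonpos_right hlower hα
  simpa using hnorm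

theorem StablyInvertible.mul (hM : StablyInvertible T M) (hN : StablyInvertible T N) :
    StablyInvertible T fun ω => M ω * N ω := by
  obtain ⟨α, β, hα, hM⟩ := hM
  obtain ⟨α', β', hα', hN⟩ := hN
  refine ⟨α * α', |β| * β', mul_pos hα hα', ?_⟩
  filter_upwards [hM, hN] with ω hM hN v
  have hcomp : Matrix.toEuclideanLin (M ω * N ω) v =
      Matrix.toEuclideanLin (M ω) (Matrix.toEuclideanLin (N ω) v) := by
    simp [Matrix.toEuclideanLin]
  rw [hcomp]
  constructor
  · calc α * α' * ‖v‖ = α * (α' * ‖v‖) := mul_assoc _ _ _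
      _ ≤ α * ‖Matrix.toEuclideanLin (N ω) v‖ := by gcongr; exact (hN v).1
      _ ≤ ‖Matrix.toEuclideanLin (M ω) (Matrix.toEuclideanLin (N ω) v)‖ := (hM _).1
  · calc ‖Matrix.toEuclideanLin (M ω) (Matrix.toEuclideanLin (N ω) v)‖
        ≤ β * ‖Matrix.toEuclideanLin (N ω) v‖ := (hM _).2
      _ ≤ |β| * ‖Matrix.toEuclideanLin (N ω) v‖ := by gcongr; exact le_abs_self β
      _ ≤ |β| * (β' * ‖v‖) := by gcongr; exact (hN v).2
      _ = |β| * β' * ‖v‖ := (mul_assoc _ _ _).symm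

theorem euclideanSpace_norm_le_norm {ι 𝕜 : Type*} [Fintype ι] [RCLike 𝕜]
    {v w : EuclideanSpace 𝕜 ι} (h : ∀ i, ‖v i‖ ≤ ‖w i‖) : ‖v‖ ≤ ‖w‖ := by
  rw [EuclideanSpace.norm_eq, EuclideanSpace.norm_eq]
  gcongr with i
  exact h i

theorem stablyInvertible_diagonal {d : ℝ → Fin p → ℂ} {α β : ℝ} (hα : 0 < α)
    (hd : ∀ᵐ ω ∂volume.restrict (period T), ∀ m, α ≤ ‖d ω m‖ ∧ ‖d ω m‖ ≤ β) :
    StablyInvertible T fun ω => Matrix.diagonal (d ω) := by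
  refine ⟨α, |β|, hα, ?_⟩
  filter_upwards [hd] with ω hd v
  have happly : ∀ m, ‖Matrix.toEuclideanLin (Matrix.diagonal (d ω)) v m‖ = ‖d ω m‖ * ‖v m‖ := by
    simp [Matrix.toEuclideanLin, Matrix.mulVec_diagonal]
  have hsmul : ∀ c : ℝ, ‖(c : ℂ) • v‖ = |c| * ‖v‖ := fun c => by
    rw [norm_smul, Complex.norm_real, Real.norm_eq_abs]
  constructor
  · rw [← abs_of_pos hα, ← hsmul]
    refine euclideanSpace_norm_le_norm fun m => ?_
    rw [happly, PiLp.smul_apply, norm_smul, Complex.norm_real, Real.norm_eq_abs, abs_of_pos hα]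
    gcongr
    exact (hd m).1
  · rw [← hsmul]
    refine euclideanSpace_norm_le_norm fun m => ?_
    rw [happly, PiLp.smul_apply, norm_smul, Complex.norm_real, Real.norm_eq_abs]
    gcongr
    exact (hd m).2.trans (le_abs_self β)

end StablyInvertible

section Sampling

variable {T : ℝ} {γ : ℤ} {p : ℕ} {s : Fin p → Signal} {x g : Signal}

/-- The vector of the `p` bands `X(ω + (2π/T)(m + γ))`, `m = 0, …, p - 1`, of a spectrum, each
translated to the period `Ω`. -/
noncomputable def bandVec (T : ℝ) (γ : ℤ) (p : ℕ) (x : Signal) (ω : ℝ) : Fin p → ℂ :=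
  fun m => ft x (ω + 2 * Real.pi / T * ((m : ℕ) + γ))

theorem memLp_bandVec (T : ℝ) (γ : ℤ) (x : Signal) (m : Fin p) :
    MemLp (fun ω => bandVec T γ p x ω m) 2 (volume.restrict (period T)) :=
  ((memLp_ft x).comp_measurePreserving (measurePreserving_add_right volume _)).restrict _

theorem matS_apply (T : ℝ) (γ : ℤ) (s : Fin p → Signal) (ω : ℝ) (l m : Fin p) :
    matS T γ s ω l m = 1 / (T : ℂ) * conj (bandVec T γ p (s l) ω m) :=
  rfl

theorem matW_eq_matS_mul_diagonal (T : ℝ) (γ : ℤ) (s : Fin p → Signal) (g : Signal) :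
    matW T γ s g = fun ω => matS T γ s ω * Matrix.diagonal (bandVec T γ p g ω) := by
  ext ω l m
  simp [matW, matS, bandVec, Matrix.mul_diagonal]

theorem stablyInvertible_matW (hT : 0 < T)
    (hG : ∃ α β : ℝ, 0 < α ∧
      ∀ᵐ ω ∂volume.restrict (band T γ p), α ≤ ‖ft g ω‖ ∧ ‖ft g ω‖ ≤ β)
    (hS : StablyInvertible T (matS T γ s)) : StablyInvertible T (matW T γ s g) := by
  obtain ⟨α, β, hα, hG⟩ := hG
  rw [matW_eq_matS_mul_diagonal]
  exact hS.mul (stablyInvertible_diagonal hα (ae_restrict_period_of_ae_restrict_band hT hG))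

theorem memLp_matS_mulVec_bandVec (hS : StablyInvertible T (matS T γ s)) (x : Signal)
    (l : Fin p) :
    MemLp (fun ω => (matS T γ s ω *ᵥ bandVec T γ p x ω) l) 2 (volume.restrict (period T)) := by
  obtain ⟨C, hC⟩ := hS.ae_norm_le
  simp only [Matrix.mulVec, dotProduct]
  refine memLp_finsetSum _ fun m _ => (memLp_bandVec T γ x m).mul' (p := ⊤) (r := 2) ?_
  refine memLp_top_of_bound ?_ C (hC.mono fun ω hω => hω l m)
  exact ((memLp_bandVec T γ (s l) m).star.aestronglyMeasurable.const_mul _)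

theorem exp_I_mul_add_band (hT : 0 < T) (ω : ℝ) (j n : ℤ) :
    Complex.exp (Complex.I * (ω + 2 * Real.pi / T * j : ℝ) * n * T) =
      Complex.exp (Complex.I * ω * n * T) := by
  have hT' : (T : ℂ) ≠ 0 := by exact_mod_cast hT.ne'
  refine Complex.exp_eq_exp_iff_exists_int.2 ⟨j * n, ?_⟩
  push_cast
  field_simp

theorem sample_eq_integral_period (hT : 0 < T) (x : Signal) {l : Fin p}
    (hs : ∀ᵐ ω : ℝ, ω ∉ band T γ p → ft (s l) ω = 0) (n : ℤ) :
    sample T x (s l) n = ((T / (2 * Real.pi) : ℝ) : ℂ) *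
      ∫ ω in period T, (matS T γ s ω *ᵥ bandVec T γ p x ω) l *
        Complex.exp (Complex.I * ω * n * T) := by
  have hT' : (T : ℂ) ≠ 0 := by exact_mod_cast hT.ne'
  set F : ℝ → ℂ := fun ω => conj (ft (s l) ω) * ft x ω * Complex.exp (Complex.I * ω * n * T)
    with hF
  have hF_int : Integrable F volume := by
    refine ((memLp_ft (s l)).star.integrable_mul (memLp_ft x)).mul_bdd (c := 1)
      (Continuous.aestronglyMeasurable (by fun_prop)) (Eventually.of_forall fun ω => ?_)
    simp [Complex.norm_exp]
  have hF_band : ∀ᵐ ω : ℝ, ω ∉ band T γ p → F ω = 0 := by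
    filter_upwards [hs] with ω hω hband
    simp [hF, hω hband]
  have hfold : ∀ ω : ℝ, ∑ m : Fin p, F (ω + 2 * Real.pi / T * ((m : ℕ) + γ)) =
      T * ((matS T γ s ω *ᵥ bandVec T γ p x ω) l * Complex.exp (Complex.I * ω * n * T)) := by
    intro ω
    simp only [Matrix.mulVec, dotProduct, Finset.sum_mul, Finset.mul_sum]
    refine Finset.sum_congr rfl fun m _ => ?_
    have hphase := exp_I_mul_add_band hT ω ((m : ℕ) + γ) n
    push_cast at hphase
    simp only [hF, matS_apply, bandVec]
    push_cast
    rw [hphase]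
    field_simp
  rw [sample_eq_integral_ft, integral_eq_sum_integral_period hT hF_int hF_band,
    ← integral_finsetSum _ fun (m : Fin p) _ => (hF_int.comp_add_right _).restrict]
  simp only [hfold]
  rw [integral_const_mul]
  push_cast
  ring

theorem sample_eq_inner_expLp (hT : 0 < T) (hS : StablyInvertible T (matS T γ s)) (x : Signal)
    {l : Fin p} (hs : ∀ᵐ ω : ℝ, ω ∉ band T γ p → ft (s l) ω = 0) (n : ℤ) :
    sample T x (s l) n = ((T / (2 * Real.pi) : ℝ) : ℂ) *
      inner ℂ (expLp T n) ((memLp_matS_mulVec_bandVec hS x l).toLp _) := by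
  rw [sample_eq_integral_period hT x hs, inner_expLp]
  congr 1
  refine integral_congr_ae ?_
  filter_upwards [(memLp_matS_mulVec_bandVec hS x l).coeFn_toLp] with ω hω
  rw [hω]

theorem memℓp_sample (hT : 0 < T) (hS : StablyInvertible T (matS T γ s)) (x : Signal)
    {l : Fin p} (hs : ∀ᵐ ω : ℝ, ω ∉ band T γ p → ft (s l) ω = 0) :
    Memℓp (sample T x (s l)) 2 :=
  memℓp_of_forall_eq_inner_expLp hT (sample_eq_inner_expLp hT hS x hs)

theorem dtftVec_sample_ae_eq (hT : 0 < T) (hS : StablyInvertible T (matS T γ s)) (x : Signal)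
    (hs : ∀ l, ∀ᵐ ω : ℝ, ω ∉ band T γ p → ft (s l) ω = 0) :
    dtftVec T (fun l => sample T x (s l)) =ᵐ[volume.restrict (period T)]
      fun ω => matS T γ s ω *ᵥ bandVec T γ p x ω := by
  have hcoord : ∀ᵐ ω ∂volume.restrict (period T), ∀ l,
      dtft T (sample T x (s l)) ω = (matS T γ s ω *ᵥ bandVec T γ p x ω) l :=
    ae_all_iff.2 fun l => by
      rw [dtft_eq_of_forall_eq_inner_expLp hT (sample_eq_inner_expLp hT hS x (hs l))]
      exact (memLp_matS_mulVec_bandVec hS x l).coeFn_toLp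
  filter_upwards [hcoord] with ω hω
  exact funext hω

end Sampling

section Multipath

variable {K p : ℕ} {T : ℝ} {γ : ℤ} {t : Fin K → ℝ} {a : Fin K → ℤ → ℂ} {g x : Signal}

theorem sum_smul_expLp_ae_eq (T : ℝ) (a : ℤ → ℂ) (S : Finset ℤ) :
    ∀ᵐ ω ∂volume.restrict (period T),
      (∑ n ∈ S, a n • expLp T n : Lp ℂ 2 (volume.restrict (period T))) ω =
        ∑ n ∈ S, dtftTerm T a n ω := by
  have hterm : ∀ᵐ ω ∂volume.restrict (period T), ∀ n ∈ S,
      (a n • expLp T n : Lp ℂ 2 (volume.restrict (period T))) ω = dtftTerm T a n ω :=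
    (Finset.eventually_all S).2 fun n _ => by
      rw [← toLp_dtftTerm]
      exact (memLp_dtftTerm T a n).coeFn_toLp
  filter_upwards [Lp.coeFn_finsetSum S fun n => a n • expLp T n, hterm] with ω hsum hterm
  rw [hsum, Finset.sum_apply]
  exact Finset.sum_congr rfl hterm

theorem exists_seq_tendsto_ae_dtft (hT : 0 < T) (ha : ∀ k, Memℓp (a k) 2) :
    ∃ ns : ℕ → ℕ, StrictMono ns ∧ ∀ᵐ ω ∂volume.restrict (period T), ∀ k,
      Tendsto (fun N => ∑ n ∈ Finset.Icc (-(ns N : ℤ)) (ns N), dtftTerm T (a k) n ω) atTop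
        (𝓝 (dtft T (a k) ω)) := by
  obtain ⟨ns, hns, hae⟩ := (tendstoInMeasure_pi fun k =>
    tendstoInMeasure_of_tendsto_Lp (tendsto_sum_Icc_smul_expLp hT (ha k))).exists_seq_tendsto_ae
  have hterm : ∀ᵐ ω ∂volume.restrict (period T), ∀ (N : ℕ) k,
      (∑ n ∈ Finset.Icc (-(N : ℤ)) N, a k n • expLp T n : Lp ℂ 2 (volume.restrict (period T))) ω =
        ∑ n ∈ Finset.Icc (-(N : ℤ)) N, dtftTerm T (a k) n ω :=
    ae_all_iff.2 fun N => ae_all_iff.2 fun k => sum_smul_expLp_ae_eq T (a k) _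
  refine ⟨ns, hns, ?_⟩
  filter_upwards [hae, hterm] with ω hω hterm k
  simpa only [hterm] using tendsto_pi_nhds.1 hω k

theorem ft_sum_smul_delay_ae_eq (T : ℝ) (g : Signal) (t : Fin K → ℝ) (a : Fin K → ℤ → ℂ)
    (S : Finset ℤ) :
    ft (∑ k, ∑ n ∈ S, a k n • delay (t k + n * T) g) =ᵐ[volume] fun ω => ft g ω *
      ∑ k, Complex.exp (-(Complex.I * ω * t k)) * ∑ n ∈ S, dtftTerm T (a k) n ω := by
  have hdelay : ∀ᵐ ω : ℝ, ∀ (k : Fin K) (n : ℤ), ft (delay (t k + n * T) g) ω =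
      Complex.exp (-(Complex.I * ω * (t k + n * T : ℝ))) * ft g ω :=
    ae_all_iff.2 fun k => ae_all_iff.2 fun n => ft_delay_ae_eq _ g
  rw [← Finset.sum_product']
  filter_upwards [hdelay, ft_finsetSum_smul_ae_eq (Finset.univ ×ˢ S) (fun i => a i.1 i.2)
    fun i => delay (t i.1 + i.2 * T) g] with ω hdelay hsum
  rw [hsum, Finset.sum_product]
  simp only [Finset.mul_sum, hdelay, dtftTerm]
  refine Finset.sum_congr rfl fun k _ => Finset.sum_congr rfl fun n _ => ?_
  have hphase : Complex.exp (-(Complex.I * ω * (t k + n * T : ℝ))) =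
      Complex.exp (-(Complex.I * ω * t k)) * Complex.exp (-(Complex.I * ω * n * T)) := by
    rw [← Complex.exp_add]
    push_cast
    ring_nf
  rw [hphase]
  ring

theorem dtftTerm_add_band (hT : 0 < T) (a : ℤ → ℂ) (n : ℤ) (ω : ℝ) (j : ℤ) :
    dtftTerm T a n (ω + 2 * Real.pi / T * j) = dtftTerm T a n ω := by
  rw [dtftTerm, dtftTerm, Complex.exp_neg, Complex.exp_neg, exp_I_mul_add_band hT]

theorem IsMultipathSignal.ft_ae_eq (hT : 0 < T) (ha : ∀ k, Memℓp (a k) 2)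
    (hx : IsMultipathSignal T g t a x) (j : ℤ) :
    ∀ᵐ ω ∂volume.restrict (period T), ft x (ω + 2 * Real.pi / T * j) =
      ft g (ω + 2 * Real.pi / T * j) *
        ∑ k, Complex.exp (-(Complex.I * (ω + 2 * Real.pi / T * j : ℝ) * t k)) *
          dtft T (a k) ω := by
  obtain ⟨ns, hns, hdtft⟩ := exists_seq_tendsto_ae_dtft hT ha
  obtain ⟨ms, hms, hft⟩ := exists_seq_tendsto_ae_ft (hx.comp hns.tendsto_atTop)
  have hpartial := ae_all_iff.2 fun N : ℕ =>
    ft_sum_smul_delay_ae_eq T g t a (Finset.Icc (-(N : ℤ)) N)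
  have hshift := quasiMeasurePreserving_add_right volume (2 * Real.pi / T * j)
  filter_upwards [hdtft, ae_restrict_of_ae (hshift.ae hft),
    ae_restrict_of_ae (hshift.ae hpartial)] with ω hdtft hft hpartial
  refine tendsto_nhds_unique hft ?_
  simp only [Function.comp_apply, hpartial, dtftTerm_add_band hT]
  exact (tendsto_finsetSum _ fun k _ =>
    ((hdtft k).comp hms.tendsto_atTop).const_mul _).const_mul _

theorem vecB_apply (T : ℝ) (t : Fin K → ℝ) (a : Fin K → ℤ → ℂ) (ω : ℝ) (k : Fin K) :
    vecB T t a ω k = Complex.exp (-(Complex.I * ω * t k)) * dtft T (a k) ω := by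
  rw [vecB, matD, Matrix.mulVec_diagonal, dtftVec]

theorem IsMultipathSignal.bandVec_ae_eq (hT : 0 < T) (ha : ∀ k, Memℓp (a k) 2)
    (hx : IsMultipathSignal T g t a x) :
    bandVec T γ p x =ᵐ[volume.restrict (period T)] fun ω =>
      Matrix.diagonal (bandVec T γ p g ω) *ᵥ (matN p T γ t *ᵥ vecB T t a ω) := by
  filter_upwards [ae_all_iff.2 fun m : Fin p => hx.ft_ae_eq hT ha ((m : ℕ) + γ)] with ω hω
  funext m
  have hm := hω m
  push_cast at hm
  rw [Matrix.mulVec_diagonal, bandVec, bandVec, hm]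
  congr 1
  simp only [Matrix.mulVec, dotProduct, matN, Matrix.of_apply, vecB_apply]
  refine Finset.sum_congr rfl fun k _ => ?_
  rw [← mul_assoc, ← Complex.exp_add]
  ring_nf

theorem vecD_ae_eq (hT : 0 < T) {s : Fin p → Signal}
    (hs : ∀ l, ∀ᵐ ω : ℝ, ω ∉ band T γ p → ft (s l) ω = 0)
    (hS : StablyInvertible T (matS T γ s)) (hW : StablyInvertible T (matW T γ s g))
    (ha : ∀ k, Memℓp (a k) 2) (hx : IsMultipathSignal T g t a x) :
    vecD T γ s g x =ᵐ[volume.restrict (period T)] fun ω => matN p T γ t *ᵥ vecB T t a ω := by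
  filter_upwards [dtftVec_sample_ae_eq hT hS x hs, hx.bandVec_ae_eq hT ha, hW.ae_isUnit_det]
    with ω hsample hband hdet
  rw [vecD, hsample, hband, Matrix.mulVec_mulVec _ (matS T γ s ω),
    ← congrFun (matW_eq_matS_mul_diagonal T γ s g) ω, Matrix.mulVec_mulVec,
    Matrix.nonsing_inv_mul _ hdet, Matrix.one_mulVec]

theorem not_ae_vecB_eq_zero (hT : 0 < T) (t : Fin K → ℝ) {k : Fin K} (ha : Memℓp (a k) 2)
    (h0 : a k ≠ 0) : ¬ ∀ᵐ ω ∂volume.restrict (period T), vecB T t a ω k = 0 := by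
  intro h
  refine dtft_ne_zero hT ha h0 ((Lp.eq_zero_iff_ae_eq_zero).2 ?_)
  filter_upwards [h] with ω hω
  rw [vecB_apply] at hω
  exact (mul_eq_zero.1 hω).resolve_left (Complex.exp_ne_zero _)

end Multipath

section Spikes

variable {ι X M : Type*} [Fintype ι] [AddCommMonoid M]

/-- The spike train `∑ᵢ bᵢ δ_{tᵢ}` as a finitely supported function. It records amplitudes and
locations but not the numbering of the spikes. -/
noncomputable def spikes (t : ι → X) (b : ι → M) : X →₀ M :=
  ∑ i, Finsupp.single (t i) (b i)

theorem support_spikes_subset [DecidableEq X] (t : ι → X) (b : ι → M) :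
    (spikes t b).support ⊆ Finset.univ.image t := by
  refine Finsupp.support_finsetSum.trans (Finset.biUnion_subset.2 fun i _ => ?_)
  exact Finsupp.support_single_subset.trans (by simp)

theorem spikes_apply_of_injective {t : ι → X} (ht : Function.Injective t) (b : ι → M) (i : ι) :
    spikes t b (t i) = b i := by
  classical
  simp [spikes, Finsupp.finsetSum_apply, Finsupp.single_apply, ht.eq_iff]

theorem spikes_apply_eq_zero {t : ι → X} {u : X} (hu : ∀ i, t i ≠ u) (b : ι → M) :
    spikes t b u = 0 := by
  simp [spikes, Finsupp.finsetSum_apply, hu]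

theorem exists_perm_of_eventually_spikes_eq {α : Type*} {l : Filter α} {t t' : ι → X}
    (ht : Function.Injective t) {b b' : α → ι → M} (hb : ∀ i, ¬ ∀ᶠ ω in l, b ω i = 0)
    (h : ∀ᶠ ω in l, spikes t (b ω) = spikes t' (b' ω)) :
    ∃ σ : Equiv.Perm ι, (∀ i, t' i = t (σ i)) ∧ ∀ᶠ ω in l, ∀ i, b' ω i = b ω (σ i) := by
  have hmatch : ∀ i, ∃ j, t' j = t i := by
    intro i
    by_contra! hi
    refine hb i (h.mono fun ω hω => ?_)
    rw [← spikes_apply_of_injective ht (b ω) i, hω, spikes_apply_eq_zero hi]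
  choose τ hτ using hmatch
  have hτ_inj : Function.Injective τ := fun i j hij => ht (by rw [← hτ, ← hτ, hij])
  let e : Equiv.Perm ι := Equiv.ofBijective τ (Finite.injective_iff_bijective.1 hτ_inj)
  have ht'_eq : ∀ i, t' i = t (e.symm i) := fun i => by
    rw [← hτ]
    exact congrArg t' (e.apply_symm_apply i).symm
  have ht' : Function.Injective t' := fun i j hij =>
    e.symm.injective (ht (by rw [← ht'_eq, ← ht'_eq, hij]))
  refine ⟨e.symm, ht'_eq, h.mono fun ω hω i => ?_⟩
  rw [← spikes_apply_of_injective ht' (b' ω) i, ← hω, ht'_eq, spikes_apply_of_injective ht]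

end Spikes

section Identifiability

variable {T : ℝ} {γ : ℤ} {p K K' : ℕ}

theorem injOn_exp_Ico (hT : 0 < T) :
    Set.InjOn (fun u : ℝ => Complex.exp (-(Complex.I * (2 * Real.pi / T) * u)))
      (Set.Ico 0 T) := by
  intro u hu v hv huv
  have : Fact (0 < T) := ⟨hT⟩
  have hcircle : AddCircle.toCircle (u : AddCircle T) = AddCircle.toCircle (v : AddCircle T) := by
    refine Circle.ext ?_
    simp only [Complex.exp_neg, inv_inj] at huv
    simp only [AddCircle.toCircle_apply_mk, Circle.coe_exp]
    push_cast
    simpa only [mul_comm, mul_left_comm] using huv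
  refine (AddCircle.coe_eq_coe_iff_of_mem_Ico (a := 0) ?_ ?_).1
    (AddCircle.injective_toCircle hT.ne' hcircle)
  all_goals rwa [zero_add]

/-- The column `(e^{-j(2π/T)(m + γ)u})ₘ` of `𝐍` that belongs to the delay `u`, called a steering
vector in array processing. -/
noncomputable def steering (p : ℕ) (T : ℝ) (γ : ℤ) (u : ℝ) : Fin p → ℂ :=
  fun m => Complex.exp (-(Complex.I * (2 * Real.pi / T) * ((m : ℕ) + γ) * u))

theorem linearIndependent_steering (hT : 0 < T) (γ : ℤ) {ι : Type*} [Fintype ι] {t : ι → ℝ}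
    (ht : ∀ i, t i ∈ Set.Ico 0 T) (ht_inj : Function.Injective t) (hp : Fintype.card ι ≤ p) :
    LinearIndependent ℂ fun i => steering p T γ (t i) := by
  let e := (Fintype.equivFin ι).symm
  refine (linearIndependent_equiv e).1 (Fintype.linearIndependent_iff.2 fun c hc => ?_)
  let node := fun i => Complex.exp (-(Complex.I * (2 * Real.pi / T) * t (e i)))
  let twist := fun i => Complex.exp (-(Complex.I * (2 * Real.pi / T) * γ * t (e i)))
  have hnode : Function.Injective node := fun i j hij =>
    e.injective (ht_inj (injOn_exp_Ico hT (ht _) (ht _) hij))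
  have hvandermonde : (fun i => c i * twist i) = 0 := by
    refine Matrix.eq_zero_of_forall_pow_sum_mul_pow_eq_zero hnode fun m => ?_
    have hrow := congrFun hc ⟨m, m.2.trans_le hp⟩
    rw [Finset.sum_apply, Pi.zero_apply] at hrow
    rw [← hrow]
    refine Finset.sum_congr rfl fun i _ => ?_
    simp only [node, twist, Function.comp_apply, Pi.smul_apply, smul_eq_mul, steering]
    rw [mul_assoc, ← Complex.exp_nat_mul, ← Complex.exp_add]
    ring_nf
  exact fun i => (mul_eq_zero.1 (congrFun hvandermonde i)).resolve_right (Complex.exp_ne_zero _)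

theorem matN_mulVec_injective (hT : 0 < T) (γ : ℤ) {t : Fin K → ℝ}
    (ht : ∀ k, t k ∈ Set.Ico 0 T) (ht_inj : Function.Injective t) (hp : K ≤ p) :
    Function.Injective (matN p T γ t).mulVec :=
  Matrix.mulVec_injective_iff.2
    (linearIndependent_steering hT γ ht ht_inj (by rwa [Fintype.card_fin]))

theorem matN_mulVec_eq_linearCombination (p : ℕ) (T : ℝ) (γ : ℤ) (t : Fin K → ℝ)
    (b : Fin K → ℂ) :
    matN p T γ t *ᵥ b = Finsupp.linearCombination ℂ (steering p T γ) (spikes t b) := by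
  simp only [spikes, map_sum, Finsupp.linearCombination_single, Matrix.mulVec_eq_sum,
    op_smul_eq_smul]
  rfl

theorem spikes_eq_of_matN_mulVec_eq (hT : 0 < T) {t : Fin K → ℝ} {t' : Fin K' → ℝ}
    (ht : ∀ k, t k ∈ Set.Ico 0 T) (ht' : ∀ k, t' k ∈ Set.Ico 0 T) (hp : K + K' ≤ p)
    {b : Fin K → ℂ} {b' : Fin K' → ℂ} (h : matN p T γ t *ᵥ b = matN p T γ t' *ᵥ b') :
    spikes t b = spikes t' b' := by
  let S := Finset.univ.image t ∪ Finset.univ.image t'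
  have hS : ∀ u : S, (u : ℝ) ∈ Set.Ico 0 T := by
    rintro ⟨u, hu⟩
    rcases Finset.mem_union.1 hu with hu | hu <;>
      obtain ⟨k, -, rfl⟩ := Finset.mem_image.1 hu
    exacts [ht k, ht' k]
  have hcard : S.card ≤ p :=
    calc S.card ≤ (Finset.univ.image t).card + (Finset.univ.image t').card :=
          Finset.card_union_le _ _
      _ ≤ K + K' := by
          gcongr <;> exact Finset.card_image_le.trans_eq (Finset.card_fin _)
      _ ≤ p := hp
  have hindep : LinearIndepOn ℂ (steering p T γ) (S : Set ℝ) :=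
    linearIndependent_steering hT γ hS Subtype.val_injective (by simpa using hcard)
  rw [matN_mulVec_eq_linearCombination, matN_mulVec_eq_linearCombination] at h
  refine linearIndepOn_iffₛ.1 hindep _ ?_ _ ?_ h
  · exact (Finsupp.mem_supported ℂ _).2 (by
      exact_mod_cast (support_spikes_subset t b).trans Finset.subset_union_left)
  · exact (Finsupp.mem_supported ℂ _).2 (by
      exact_mod_cast (support_spikes_subset t' b').trans Finset.subset_union_right)

end Identifiability

theorem pinv_mul_self_of_injective {m n : ℕ} {A : Matrix (Fin m) (Fin n) ℂ}
    (hA : Function.Injective A.mulVec) : pinv A * A = 1 := by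
  refine Matrix.mulVec_injective (funext fun v => hA ?_)
  rw [Matrix.mulVec_mulVec, ← Matrix.mul_assoc, (isMoorePenrose_pinv A).mul_mul_self,
    Matrix.one_mulVec]

theorem isUnit_det_matD {K : ℕ} (t : Fin K → ℝ) (ω : ℝ) : IsUnit (matD t ω).det := by
  rw [matD, Matrix.det_diagonal, isUnit_iff_ne_zero]
  exact Finset.prod_ne_zero_iff.2 fun k _ => Complex.exp_ne_zero _

end TimeDelay

theorem proposition1 {K p : ℕ} (T : ℝ) (hT : 0 < T) (γ : ℤ)
    (g : Signal) (t : Fin K → ℝ) (ht : ∀ k, t k ∈ Set.Ico 0 T) (ht_inj : Function.Injective t)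
    (a : Fin K → ℤ → ℂ) (ha : ∀ k, Memℓp (a k) 2)
    (x : Signal) (hx : IsMultipathSignal T g t a x)
    (s : Fin p → Signal)
    (hs : ∀ l, ∀ᵐ ω : ℝ, ω ∉ band T γ p → ft (s l) ω = 0)
    (hG : ∃ α β : ℝ, 0 < α ∧
      ∀ᵐ ω ∂volume.restrict (band T γ p), α ≤ ‖ft g ω‖ ∧ ‖ft g ω‖ ≤ β)
    (hS : StablyInvertible T (matS T γ s)) :
    -- the sample sequences have discrete-time Fourier transforms, and `𝐖⁻¹` is a stable filter
    (∀ l, Memℓp (sample T x (s l)) 2) ∧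
    StablyInvertible T (matW T γ s g) ∧
    -- `𝐝 = 𝐍(τ) 𝐛`
    (∀ᵐ ω ∂volume.restrict (period T),
      vecD T γ s g x ω = matN p T γ t *ᵥ vecB T t a ω) ∧
    -- these equations determine the delays and `𝐛` up to the numbering of the paths
    (2 * K ≤ p → (∀ k, a k ≠ 0) →
      ∀ (t' : Fin K → ℝ) (b' : ℝ → Fin K → ℂ),
        (∀ k, t' k ∈ Set.Ico 0 T) → Function.Injective t' →
        (∀ᵐ ω ∂volume.restrict (period T), vecD T γ s g x ω = matN p T γ t' *ᵥ b' ω) →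
        ∃ σ : Equiv.Perm (Fin K), (∀ k, t' k = t (σ k)) ∧
          ∀ᵐ ω ∂volume.restrict (period T), ∀ k, b' ω k = vecB T t a ω (σ k)) ∧
    -- `𝐚 = 𝐃⁻¹ 𝐍† 𝐝`
    (K ≤ p → ∀ᵐ ω ∂volume.restrict (period T),
      dtftVec T a ω = (matD t ω)⁻¹ *ᵥ (pinv (matN p T γ t) *ᵥ vecD T γ s g x ω)) := by
  have hW := stablyInvertible_matW hT hG hS
  have hD := vecD_ae_eq hT hs hS hW ha hx
  refine ⟨fun l => memℓp_sample hT hS x (hs l), hW, hD, fun hp h0 t' b' ht' _ h => ?_,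
    fun hp => ?_⟩
  · refine exists_perm_of_eventually_spikes_eq ht_inj
      (fun k => not_ae_vecB_eq_zero hT t (ha k) (h0 k)) ?_
    filter_upwards [hD, h] with ω hd hd'
    exact spikes_eq_of_matN_mulVec_eq hT ht ht' (by omega) (hd.symm.trans hd')
  · filter_upwards [hD] with ω hd
    rw [hd, Matrix.mulVec_mulVec (vecB T t a ω),
      pinv_mul_self_of_injective (matN_mulVec_injective hT γ ht ht_inj hp), Matrix.one_mulVec, vecB,
      Matrix.mulVec_mulVec, Matrix.nonsing_inv_mul _ (isUnit_det_matD t ω), Matrix.one_mulVec]
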